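/- Let $N\ge 1$ be an integer, $s\in(0,1)$, $p>1$ with $sp<N$, and set $p^*=\frac{Np}{N-sp}$ and $q_0=\frac{(p-1)N}{N-sp}$. Let $$D^{s,p}(\mathbb R^N)=\Big\{u\in L^{p^*}(\mathbb R^N):\ [u]_{s,p}^p:=\int_{\mathbb R^{2N}}\frac{|u(x)-u(y)|^p}{|x-y|^{N+sp}}\,dx\,dy<\infty\Big\},$$ and let $U\in D^{s,p}(\mathbb R^N)$ be a non-negative solution of the minimization problem $$\mathcal S_{p,s}=\inf\Big\{[u]_{s,p}^p:\ u\in D^{s,p}(\mathbb R^N),\ \int_{\mathbb R^N}|u|^{p^*}\,dx=1\Big\},$$ that is, $U\ge 0$ almost everywhere, $\int_{\mathbb R^N}|U|^{p^*}\,dx=1$ and $[U]_{s,p}^p=\mathcal S_{p,s}$. Then $U\in L^q(\mathbb R^N)$ for every real $q>q_0$. Moreover $U$ belongs to the weak Lebesgue (Lorentz) space $L^{q_0,\infty}(\mathbb R^N)$, i.e. $\sup_{t>0}t\,|\{|U|>t\}|^{1/q_0}<\infty$, with the estimate $$\sup_{t>0}\,t\,|\{U>t\}|^{1/q_0}\ \le\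 \|U\|_{p^*-1}^{\frac{p^*-1}{p-1}},$$ where $|E|$ denotes the Lebesgue measure of $E$ and, for $r>0$, $\|U\|_r=\big(\int_{\mathbb R^N}|U|^r\,dx\big)^{1/r}$. -/

import Mathlib

open MeasureTheory
open scoped ENNReal

noncomputable section

namespace FracSobolev

/-- The critical exponent `p* = N p / (N - s p)`. -/
def critExp (N : ℕ) (s p : ℝ) : ℝ := (N : ℝ) * p / ((N : ℝ) - s * p)

/-- The borderline exponent `q₀ = (p - 1) N / (N - s p)`. -/
def borderExp (N : ℕ) (s p : ℝ) : ℝ := (p - 1) * (N : ℝ) / ((N : ℝ) - s * p)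

/-- The `p`-th power of the Gagliardo seminorm,
`[u]_{s,p}^p = ∫_{ℝ^{2N}} |u(x) - u(y)|^p / |x - y|^{N + s p} dx dy`, with values in `[0, ∞]`. -/
def gagliardoEnergy {N : ℕ} (s p : ℝ) (u : EuclideanSpace ℝ (Fin N) → ℝ) : ℝ≥0∞ :=
  ∫⁻ z : EuclideanSpace ℝ (Fin N) × EuclideanSpace ℝ (Fin N),
    ENNReal.ofReal (|u z.1 - u z.2| ^ p / ‖z.1 - z.2‖ ^ ((N : ℝ) + s * p))

/-- Membership in the homogeneous fractional Sobolev space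
`D^{s,p}(ℝ^N) = {u ∈ L^{p*}(ℝ^N) : [u]_{s,p} < ∞}`. -/
def MemD {N : ℕ} (s p : ℝ) (u : EuclideanSpace ℝ (Fin N) → ℝ) : Prop :=
  MemLp u (ENNReal.ofReal (critExp N s p)) volume ∧ gagliardoEnergy s p u < ∞

/-- The admissible functions: `u ∈ D^{s,p}(ℝ^N)` with `∫_{ℝ^N} |u|^{p*} dx = 1`. -/
def Admissible {N : ℕ} (s p : ℝ) (u : EuclideanSpace ℝ (Fin N) → ℝ) : Prop :=
  MemD s p u ∧ ∫ x, |u x| ^ critExp N s p = 1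

/-- The sharp Sobolev constant `S_{p,s}`: the infimum of `[u]_{s,p}^p` over admissible `u`. -/
def sobolevConst (N : ℕ) (s p : ℝ) : ℝ≥0∞ :=
  ⨅ (u : EuclideanSpace ℝ (Fin N) → ℝ) (_ : Admissible s p u), gagliardoEnergy s p u

/-- `U` solves the minimization problem: it is admissible and attains the infimum. -/
def IsMinimizer {N : ℕ} (s p : ℝ) (U : EuclideanSpace ℝ (Fin N) → ℝ) : Prop :=
  Admissible s p U ∧ gagliardoEnergy s p U = sobolevConst N s p

/-- The weak `L^q` quasinorm `sup_{t > 0} t |{x : |u(x)| > t}|^{1/q}`, with values in `[0, ∞]`. -/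
def weakLpNorm {N : ℕ} (q : ℝ) (u : EuclideanSpace ℝ (Fin N) → ℝ) : ℝ≥0∞ :=
  ⨆ (t : ℝ) (_ : 0 < t), ENNReal.ofReal t * volume {x | t < |u x|} ^ (1 / q)

/-- Membership in the Lorentz space `L^{q,∞}(ℝ^N)`. -/
def MemWeakLp {N : ℕ} (q : ℝ) (u : EuclideanSpace ℝ (Fin N) → ℝ) : Prop :=
  AEStronglyMeasurable u volume ∧ weakLpNorm q u < ∞

end FracSobolev

end

/-!
Write `r = p*`, and let `U ≥ 0` be a minimizer. Everything follows from one inequality,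
`IsTestPair.eLpNorm_comp_rpow_le`: if `g` is nondecreasing and Lipschitz on `[0, ∞)` with
`g 0 = 0`, and `G` is a primitive of `(g')^{1/p}`, then

  `‖G(U)‖_r ^ p ≤ ∫ U ^ (r - 1) * g(U)`.

This is the Euler–Lagrange equation tested with `g(U)`, but no equation is derived. Instead `U` is
compared with `U - ε g(U)`. Convexity of `t ↦ t ^ p` shows that the energy drops by at least
`p ε (1 - ε L) ^ (p - 1) [G(U)]^p` (`IsTestPair.gagliardoEnergy_add_le`), while
`∫ (U - ε g(U)) ^ r ≥ 1 - r ε ∫ U ^ (r - 1) g(U)`. The Sobolev inequality with the best constant,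
which is the definition of that constant up to scaling, bounds both energies below, and `ε → 0` gives
the claim. The best constant cancels: it is positive because it is attained
(`IsMinimizer.sobolevConst_ne_zero`), so the fractional Sobolev inequality itself is not needed.

The weak-type estimate is the case `g = G = min (·, t)` combined with Chebyshev's inequality
(`IsMinimizer.mul_volume_rpow_le`).

For `U ∈ L^q`, put `γ = q / r - 1` and take `G(t) = ∫₀ᵗ w` and `g(t) = ∫₀ᵗ w^p`, where the weight `w`
is the power `t ^ γ` truncated at infinity if `q ≥ r`, and at zero if `q₀ < q < r`; the latter needs
`γ p > -1`, which says precisely `q > q₀`. With `F = U w(U)` the inequality becomes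
`‖F‖_r ^ p ≤ C ∫ U ^ (r - p) F ^ p` with `C` independent of the truncation. On `{U > K}` with `K`
large, respectively `{U ≤ K}` with `K` small, the right-hand side is absorbed by Hölder's inequality;
on the complement it is bounded because `∫ U ^ r = 1` and `w(U) ≤ K ^ γ`
(`IsMinimizer.eLpNorm_mul_weight_rpow_le_of_small`). Fatou's lemma removes the truncation. A single
step reaches every `q`, without iteration.
-/

open MeasureTheory
open scoped ENNReal

namespace FracSobolev

open Set Filter Topology

/-! ### Tangent line inequalities for real powers -/

theorem rpow_sub_rpow_le_mul_sub {q a b : ℝ} (hq : 1 ≤ q) (hb : 0 ≤ b) (hba : b ≤ a) :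
    a ^ q - b ^ q ≤ q * a ^ (q - 1) * (a - b) := by
  rcases (hb.trans hba).eq_or_lt with h | ha
  · obtain rfl : b = 0 := by linarith
    subst h; simp
  have h := one_add_mul_self_le_rpow_one_add (s := b / a - 1) (by linarith [div_nonneg hb ha.le]) hq
  rw [add_sub_cancel, Real.div_rpow hb ha.le, le_div_iff₀ (by positivity)] at h
  have e : a ^ q = a ^ (q - 1) * a := by
    rw [← Real.rpow_add_one ha.ne']; congr 1; ring
  have : (1 + q * (b / a - 1)) * a ^ q = a ^ q - q * a ^ (q - 1) * (a - b) := by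
    rw [e]; field_simp; ring
  linarith

theorem mul_sub_le_rpow_sub_rpow {q a b : ℝ} (hq : 1 ≤ q) (ha : 0 ≤ a) (hb : 0 ≤ b) :
    q * b ^ (q - 1) * (a - b) ≤ a ^ q - b ^ q := by
  rcases hb.eq_or_lt with h | hb
  · subst h
    rcases hq.eq_or_lt with h | h
    · subst h; simp
    · rw [Real.zero_rpow (by linarith), Real.zero_rpow (by linarith)]
      simpa using Real.rpow_nonneg ha q
  have h := one_add_mul_self_le_rpow_one_add (s := a / b - 1) (by linarith [div_nonneg ha hb.le]) hq
  rw [add_sub_cancel, Real.div_rpow ha hb.le, le_div_iff₀ (by positivity)] at h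
  have e : b ^ q = b ^ (q - 1) * b := by
    rw [← Real.rpow_add_one hb.ne']; congr 1; ring
  have : (1 + q * (a / b - 1)) * b ^ q = b ^ q + q * b ^ (q - 1) * (a - b) := by
    rw [e]; field_simp
  linarith

/-! ### The best constant -/

variable {N : ℕ} {s p : ℝ} {u v U : EuclideanSpace ℝ (Fin N) → ℝ}

theorem gagliardoEnergy_congr_ae (h : u =ᵐ[volume] v) :
    gagliardoEnergy s p u = gagliardoEnergy s p v := by
  refine lintegral_congr_ae ?_
  rw [Measure.volume_eq_prod]
  filter_upwards [Measure.quasiMeasurePreserving_fst.ae_eq_comp h,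
    Measure.quasiMeasurePreserving_snd.ae_eq_comp h] with z h1 h2
  simp only [Function.comp_apply] at h1 h2
  rw [h1, h2]

theorem IsMinimizer.congr_ae (hu : IsMinimizer s p u) (h : u =ᵐ[volume] v) :
    IsMinimizer s p v := by
  obtain ⟨⟨⟨h1, h2⟩, h3⟩, h4⟩ := hu
  refine ⟨⟨⟨h1.ae_eq h, gagliardoEnergy_congr_ae (s := s) (p := p) h ▸ h2⟩, ?_⟩,
    gagliardoEnergy_congr_ae (s := s) (p := p) h ▸ h4⟩
  rw [← h3]
  refine integral_congr_ae ?_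
  filter_upwards [h] with x hx
  rw [hx]

theorem gagliardoEnergy_const_mul {c : ℝ} (hc : 0 ≤ c) :
    gagliardoEnergy s p (fun x => c * u x) = ENNReal.ofReal (c ^ p) * gagliardoEnergy s p u := by
  unfold gagliardoEnergy
  rw [← lintegral_const_mul' _ _ ENNReal.ofReal_ne_top]
  congr with z
  rw [← ENNReal.ofReal_mul (by positivity), ← mul_sub, abs_mul, abs_of_nonneg hc,
    Real.mul_rpow hc (abs_nonneg _), mul_div_assoc]

theorem lt_critExp (hs0 : 0 < s) (hp : 1 < p) (hN : s * p < N) : p < critExp N s p := by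
  have : 0 < s * p := by positivity
  rw [critExp, lt_div_iff₀ (by linarith)]
  nlinarith

theorem eLpNorm_rpow_eq_integral {r : ℝ} (hr : 0 < r) (hu : MemLp u (ENNReal.ofReal r) volume)
    (p : ℝ) (hp : 0 ≤ p) :
    eLpNorm u (ENNReal.ofReal r) volume ^ p = ENNReal.ofReal ((∫ x, |u x| ^ r) ^ (p / r)) := by
  have h := hu.eLpNorm_eq_integral_rpow_norm (by simpa using hr) ENNReal.ofReal_ne_top
  rw [ENNReal.toReal_ofReal hr.le] at h
  have h0 : 0 ≤ ∫ x, |u x| ^ r := integral_nonneg fun x => by positivity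
  rw [h, ENNReal.ofReal_rpow_of_nonneg (by simp only [Real.norm_eq_abs]; positivity) hp]
  simp only [Real.norm_eq_abs]
  rw [← Real.rpow_mul h0]
  congr 2
  field_simp

/-- The Sobolev inequality with the best constant, obtained from the definition of the infimum by
scaling. Nothing is claimed about the positivity of the constant. -/
theorem sobolevConst_mul_eLpNorm_rpow_le (hp : 0 < p) (hr : 0 < critExp N s p) (hv : MemD s p v) :
    sobolevConst N s p * eLpNorm v (ENNReal.ofReal (critExp N s p)) volume ^ p
      ≤ gagliardoEnergy s p v := by
  set r := critExp N s p with hrdef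
  set A := ∫ x, |v x| ^ r with hA
  have hA0 : 0 ≤ A := integral_nonneg fun x => by positivity
  rw [eLpNorm_rpow_eq_integral hr hv.1 p hp.le, ← hA]
  rcases hA0.eq_or_lt with h | hA0
  · rw [← h, Real.zero_rpow (by positivity)]; simp
  have hc : 0 ≤ A ^ (-1 / r) := by positivity
  have hadm : Admissible s p (fun x => A ^ (-1 / r) * v x) := by
    refine ⟨⟨hv.1.const_mul _, ?_⟩, ?_⟩
    · rw [gagliardoEnergy_const_mul hc]
      exact ENNReal.mul_lt_top ENNReal.ofReal_lt_top hv.2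
    · simp_rw [← hrdef, abs_mul, Real.mul_rpow (abs_nonneg _) (abs_nonneg _), abs_of_nonneg hc,
        ← Real.rpow_mul hA0.le]
      rw [integral_const_mul, ← hA, div_mul_cancel₀ _ hr.ne', Real.rpow_neg_one,
        inv_mul_cancel₀ hA0.ne']
  have h1 : sobolevConst N s p ≤ gagliardoEnergy s p (fun x => A ^ (-1 / r) * v x) :=
    iInf₂_le (α := ℝ≥0∞) (fun x => A ^ (-1 / r) * v x) hadm
  rw [gagliardoEnergy_const_mul hc] at h1
  calc _ ≤ ENNReal.ofReal ((A ^ (-1 / r)) ^ p) * gagliardoEnergy s p v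
        * ENNReal.ofReal (A ^ (p / r)) := by gcongr
    _ = gagliardoEnergy s p v := by
        rw [mul_right_comm, ← ENNReal.ofReal_mul (by positivity), ← Real.rpow_mul hA0.le,
          ← Real.rpow_add hA0]
        have : -1 / r * p + p / r = 0 := by ring
        simp [this]

/-- The infimum is positive because it is attained: a function of zero energy is constant almost
everywhere, and no constant has unit norm on a space of infinite measure. -/
theorem IsMinimizer.sobolevConst_ne_zero (hN : 0 < N) (hU : IsMinimizer s p U) :
    sobolevConst N s p ≠ 0 := by
  intro h0
  obtain ⟨⟨⟨h1, h2⟩, h3⟩, h4⟩ := hU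
  rw [h0] at h4
  have hUm := h1.1.aemeasurable
  have hae : ∀ᵐ z : EuclideanSpace ℝ (Fin N) × EuclideanSpace ℝ (Fin N)
      ∂(volume.prod volume), U z.1 = U z.2 := by
    rw [gagliardoEnergy, Measure.volume_eq_prod, lintegral_eq_zero_iff'] at h4
    · filter_upwards [h4] with z hz
      by_contra hne
      have hz1 : z.1 - z.2 ≠ 0 := fun h => hne (by rw [sub_eq_zero.1 h])
      have : 0 < |U z.1 - U z.2| ^ p / ‖z.1 - z.2‖ ^ ((N : ℝ) + s * p) := by
        have := abs_pos.2 (sub_ne_zero.2 hne)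
        have := norm_pos_iff.2 hz1
        positivity
      simp only [Pi.zero_apply, ENNReal.ofReal_eq_zero] at hz
      linarith
    · have hm1 := hUm.comp_quasiMeasurePreserving
        (Measure.quasiMeasurePreserving_fst (μ := volume) (ν := (volume :
          Measure (EuclideanSpace ℝ (Fin N)))))
      have hm2 := hUm.comp_quasiMeasurePreserving
        (Measure.quasiMeasurePreserving_snd (ν := volume) (μ := (volume :
          Measure (EuclideanSpace ℝ (Fin N)))))
      have hm3 := ((hm1.sub hm2).abs).pow_const p
      refine (hm3.div ?_).ennreal_ofReal
      fun_prop
  have : Nonempty (Fin N) := ⟨⟨0, hN⟩⟩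
  obtain ⟨x, hx⟩ := (Measure.ae_ae_of_ae_prod hae).exists
  have : ∫ y, |U y| ^ critExp N s p = ∫ _ : EuclideanSpace ℝ (Fin N), |U x| ^ critExp N s p := by
    refine integral_congr_ae ?_
    filter_upwards [hx] with y hy
    rw [← hy]
  rw [h3, integral_const] at this
  simp [Measure.real] at this

/-! ### The Euler–Lagrange inequality -/

/-- A pair of functions on `[0, ∞)` that yields a test function `g ∘ U` for the minimization
problem: `g` is nondecreasing and `L`-Lipschitz, and `G` is a primitive of `(g')^{1/p}`. Of the
latter only the consequence `|G a - G b|^p ≤ (a - b)^{p-1} (g a - g b)` is recorded. -/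
structure IsTestPair (p L : ℝ) (g G : ℝ → ℝ) : Prop where
  measurable_left : Measurable g
  measurable_right : Measurable G
  left_zero : g 0 = 0
  right_zero : G 0 = 0
  mono : ∀ ⦃a b⦄, 0 ≤ b → b ≤ a → 0 ≤ g a - g b
  lipschitz : ∀ ⦃a b⦄, 0 ≤ b → b ≤ a → g a - g b ≤ L * (a - b)
  abs_sub_rpow_le : ∀ ⦃a b⦄, 0 ≤ b → b ≤ a →
    |G a - G b| ^ p ≤ (a - b) ^ (p - 1) * (g a - g b)

variable {L : ℝ} {g G : ℝ → ℝ}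

theorem IsTestPair.left_nonneg (h : IsTestPair p L g G) {a : ℝ} (ha : 0 ≤ a) : 0 ≤ g a := by
  simpa [h.left_zero] using h.mono le_rfl ha

theorem IsTestPair.left_le (h : IsTestPair p L g G) {a : ℝ} (ha : 0 ≤ a) : g a ≤ L * a := by
  simpa [h.left_zero] using h.lipschitz le_rfl ha

theorem IsTestPair.abs_right_le (h : IsTestPair p L g G) (hp : 1 < p) (hL : 0 ≤ L) {a : ℝ}
    (ha : 0 ≤ a) : |G a| ≤ L ^ (1 / p) * a := by
  have h1 := h.abs_sub_rpow_le le_rfl ha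
  rw [h.right_zero, h.left_zero, sub_zero, sub_zero, sub_zero] at h1
  have h2 : a ^ (p - 1) * g a ≤ (L ^ (1 / p) * a) ^ p := by
    rw [Real.mul_rpow (by positivity) ha, ← Real.rpow_mul hL, one_div_mul_cancel (by positivity),
      Real.rpow_one]
    rcases ha.eq_or_lt with h0 | h0
    · subst h0; simp [h.left_zero, Real.zero_rpow (show p ≠ 0 by positivity)]
    · have : a ^ p = a ^ (p - 1) * a := by
        rw [← Real.rpow_add_one h0.ne']; congr 1; ring
      rw [this]
      nlinarith [h.left_le ha, Real.rpow_nonneg ha (p - 1)]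
  exact (Real.rpow_le_rpow_iff (abs_nonneg _) (by positivity) (by linarith)).1 (h1.trans h2)

/-- The pointwise gain when `a, b` are moved to `a - ε g(a), b - ε g(b)`: convexity of `t ↦ t ^ p`
bounds the decrease of `|a - b| ^ p` below. -/
theorem IsTestPair.gain_le (h : IsTestPair p L g G) (hp : 1 < p) {ε : ℝ}
    (hε : 0 ≤ ε) (hεL : ε * L ≤ 1) {a b : ℝ} (ha : 0 ≤ a) (hb : 0 ≤ b) :
    |(a - ε * g a) - (b - ε * g b)| ^ p + p * ε * (1 - ε * L) ^ (p - 1) * |G a - G b| ^ p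
      ≤ |a - b| ^ p := by
  wlog hba : b ≤ a generalizing a b
  · have := this hb ha (le_of_not_ge hba)
    rwa [abs_sub_comm, abs_sub_comm (G b), abs_sub_comm b] at this
  have h1 := h.mono hb hba
  have h2 := h.lipschitz hb hba
  have h3 := h.abs_sub_rpow_le hb hba
  have h4 : (1 - ε * L) * (a - b) ≤ (a - ε * g a) - (b - ε * g b) := by nlinarith
  have h5 : 0 ≤ (1 - ε * L) * (a - b) := mul_nonneg (by linarith) (by linarith)
  have h6 := mul_sub_le_rpow_sub_rpow (q := p) hp.le (sub_nonneg.2 hba) (h5.trans h4)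
  rw [abs_of_nonneg (h5.trans h4), abs_of_nonneg (sub_nonneg.2 hba)]
  have h7 : ((1 - ε * L) * (a - b)) ^ (p - 1) ≤ ((a - ε * g a) - (b - ε * g b)) ^ (p - 1) :=
    Real.rpow_le_rpow h5 h4 (by linarith)
  rw [Real.mul_rpow (by linarith) (by linarith)] at h7
  have h8 : (0 : ℝ) ≤ (1 - ε * L) ^ (p - 1) := Real.rpow_nonneg (by linarith) _
  calc _ ≤ (a - ε * g a - (b - ε * g b)) ^ p
        + p * ε * (1 - ε * L) ^ (p - 1) * ((a - b) ^ (p - 1) * (g a - g b)) := by gcongr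
    _ = (a - ε * g a - (b - ε * g b)) ^ p
        + p * ((1 - ε * L) ^ (p - 1) * (a - b) ^ (p - 1)) * (ε * (g a - g b)) := by ring
    _ ≤ (a - ε * g a - (b - ε * g b)) ^ p
        + p * (a - ε * g a - (b - ε * g b)) ^ (p - 1) * (ε * (g a - g b)) := by gcongr
    _ ≤ _ := by
      have : a - b - (a - ε * g a - (b - ε * g b)) = ε * (g a - g b) := by ring
      rw [this] at h6
      linarith

theorem IsTestPair.gagliardoEnergy_add_le (h : IsTestPair p L g G) (hp : 1 < p) {ε : ℝ}
    (hε : 0 ≤ ε) (hεL : ε * L ≤ 1) (hU : ∀ x, 0 ≤ U x) :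
    gagliardoEnergy s p (fun x => U x - ε * g (U x))
      + ENNReal.ofReal (p * ε * (1 - ε * L) ^ (p - 1)) * gagliardoEnergy s p (fun x => G (U x))
      ≤ gagliardoEnergy s p U := by
  have h8 : (0 : ℝ) ≤ p * ε * (1 - ε * L) ^ (p - 1) :=
    mul_nonneg (by positivity) (Real.rpow_nonneg (by linarith) _)
  unfold gagliardoEnergy
  rw [← lintegral_const_mul' _ _ ENNReal.ofReal_ne_top]
  refine (le_lintegral_add _ _).trans (lintegral_mono fun z => ?_)
  dsimp only
  rw [← ENNReal.ofReal_mul h8, ← ENNReal.ofReal_add (by positivity) (by positivity),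
    ← mul_div_assoc, ← add_div]
  gcongr
  exact h.gain_le hp hε hεL (hU _) (hU _)

/-- If `(1 - r I ε)^{p/r} + p ε (1 - ε L)^{p-1} J ≤ 1` for all small `ε > 0`, then `J ≤ I`, by
differentiation at `ε = 0`. -/
theorem le_of_rpow_add_le_one {p r L I J ε₀ : ℝ} (hp : 0 < p) (hr : 0 < r) (hε₀ : 0 < ε₀)
    (h : ∀ ε ∈ Ioo 0 ε₀, (1 - ε * (r * I)) ^ (p / r) + p * ε * (1 - ε * L) ^ (p - 1) * J ≤ 1) :
    J ≤ I := by
  have hd1 : HasDerivAt (fun ε : ℝ => 1 - ε * (r * I)) (-(r * I)) 0 := by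
    simpa using ((hasDerivAt_id (0 : ℝ)).mul_const (r * I)).const_sub 1
  have hd2 : HasDerivAt (fun ε : ℝ => 1 - ε * L) (-L) 0 := by
    simpa using ((hasDerivAt_id (0 : ℝ)).mul_const L).const_sub 1
  have hd3 : HasDerivAt (fun ε : ℝ => p * ε) p 0 := by
    simpa using (hasDerivAt_id (0 : ℝ)).const_mul p
  have hd := (hd1.rpow_const (p := p / r) (Or.inl (by simp))).add
    ((hd3.mul (hd2.rpow_const (p := p - 1) (Or.inl (by simp)))).mul_const J)
  have ht := hd.tendsto_slope_zero_right
  have hle := le_of_tendsto ht (b := 0) (by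
    filter_upwards [Ioo_mem_nhdsGT hε₀] with ε hε
    have := h ε hε
    simp only [zero_add, Pi.add_apply, Pi.mul_apply, smul_eq_mul, zero_mul, sub_zero, mul_zero,
      Real.one_rpow, add_zero]
    exact mul_nonpos_of_nonneg_of_nonpos (inv_nonneg.2 hε.1.le) (by linarith))
  have e : -(r * I) * (p / r) = -(p * I) := by field_simp
  simp only [zero_mul, sub_zero, Real.one_rpow, mul_one, mul_zero, zero_mul, add_zero, e] at hle
  nlinarith

/-- The Euler–Lagrange inequality of the minimizer tested with `g ∘ U`, in which the best constant
has cancelled. -/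
theorem IsTestPair.eLpNorm_comp_rpow_le (h : IsTestPair p L g G) (hL : 0 ≤ L) (hs0 : 0 < s)
    (hp : 1 < p) (hN : s * p < N) (hU : IsMinimizer s p U) (hUm : Measurable U)
    (hU0 : ∀ x, 0 ≤ U x) :
    eLpNorm (fun x => G (U x)) (ENNReal.ofReal (critExp N s p)) volume ^ p
      ≤ ∫⁻ x, ENNReal.ofReal (U x ^ (critExp N s p - 1) * g (U x)) := by
  have hpr := lt_critExp hs0 hp hN
  have hNpos : 0 < N := by
    have : (0 : ℝ) < N := by nlinarith
    exact_mod_cast this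
  have hS0 := hU.sobolevConst_ne_zero hNpos
  obtain ⟨⟨⟨hULp, hUE⟩, hU1⟩, hUS⟩ := hU
  have hST : sobolevConst N s p ≠ ∞ := hUS ▸ hUE.ne
  have hsob : ∀ v : EuclideanSpace ℝ (Fin N) → ℝ, MemD s p v → _ := fun v hv =>
    sobolevConst_mul_eLpNorm_rpow_le (by linarith) (by linarith) hv
  set r := critExp N s p with hr
  have hUi : Integrable (fun x => U x ^ r) := by
    have := hULp.integrable_norm_rpow (by simpa using by linarith) ENNReal.ofReal_ne_top
    rw [ENNReal.toReal_ofReal (by linarith)] at this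
    refine this.congr (ae_of_all _ fun x => ?_)
    simp [abs_of_nonneg (hU0 x)]
  have hU1' : ∫ x, U x ^ r = 1 := by
    rw [← hU1]; congr with x; rw [abs_of_nonneg (hU0 x)]
  have hgm := h.measurable_left
  have hGm := h.measurable_right
  have hpt : ∀ x, U x ^ (r - 1) * g (U x) ≤ L * U x ^ r := fun x => by
    have e : U x ^ r = U x ^ (r - 1) * U x := by
      rcases (hU0 x).eq_or_lt with h0 | h0
      · rw [← h0, mul_zero, Real.zero_rpow (by linarith)]
      · rw [← Real.rpow_add_one h0.ne']; congr 1; ring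
    rw [e]
    nlinarith [h.left_le (hU0 x), Real.rpow_nonneg (hU0 x) (r - 1)]
  have hpt0 : ∀ x, 0 ≤ U x ^ (r - 1) * g (U x) := fun x =>
    mul_nonneg (Real.rpow_nonneg (hU0 x) _) (h.left_nonneg (hU0 x))
  have hIi : Integrable (fun x => U x ^ (r - 1) * g (U x)) := by
    refine (hUi.const_mul L).mono' ?_ (ae_of_all _ fun x => ?_)
    · exact ((hUm.pow_const _).mul (hgm.comp hUm)).aestronglyMeasurable
    · rw [Real.norm_of_nonneg (hpt0 x)]; exact hpt x
  set I := ∫ x, U x ^ (r - 1) * g (U x) with hI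
  rw [← ofReal_integral_eq_lintegral_ofReal hIi (ae_of_all _ hpt0), ← hI]
  have hGLp : MemLp (fun x => G (U x)) (ENNReal.ofReal r) volume := by
    refine (hULp.const_mul (L ^ (1 / p))).mono (hGm.comp hUm).aestronglyMeasurable
      (ae_of_all _ fun x => ?_)
    rw [Real.norm_eq_abs, Real.norm_eq_abs, abs_of_nonneg (mul_nonneg (by positivity) (hU0 x))]
    exact h.abs_right_le hp hL (hU0 x)
  rw [eLpNorm_rpow_eq_integral (by linarith) hGLp p (by linarith)]
  set J := (∫ x, |G (U x)| ^ r) ^ (p / r) with hJ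
  have hJ0 : 0 ≤ J := Real.rpow_nonneg (integral_nonneg fun x => by positivity) _
  have hI0 : 0 ≤ I := integral_nonneg hpt0
  -- the smallness of `ε` keeps `1 - ε L` and `1 - r I ε` positive
  refine ENNReal.ofReal_le_ofReal (le_of_rpow_add_le_one (p := p) (r := r) (L := L)
    (ε₀ := 1 / (1 + L + r * I)) (by linarith) (by linarith) (by
      have : 0 ≤ r * I := mul_nonneg (by linarith) hI0
      positivity) ?_)
  rintro ε ⟨hε0, hε1⟩
  have hrI : 0 ≤ r * I := mul_nonneg (by linarith) hI0
  rw [lt_div_iff₀ (by positivity)] at hε1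
  have hεL : ε * L < 1 := by nlinarith
  have hεI : 0 < 1 - ε * (r * I) := by nlinarith
  have hc0 : 0 < p * ε * (1 - ε * L) ^ (p - 1) :=
    mul_pos (by positivity) (Real.rpow_pos_of_pos (by linarith) _)
  have hen := h.gagliardoEnergy_add_le (s := s) hp hε0.le hεL.le hU0
  have hvle : ∀ x, U x - ε * g (U x) ≤ U x := fun x => by
    nlinarith [h.left_nonneg (hU0 x)]
  have hvge : ∀ x, 0 ≤ U x - ε * g (U x) := fun x => by
    nlinarith [h.left_le (hU0 x), hU0 x]
  have hvLp : MemLp (fun x => U x - ε * g (U x)) (ENNReal.ofReal r) volume := by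
    refine hULp.mono (hUm.sub ((hgm.comp hUm).const_mul ε)).aestronglyMeasurable
      (ae_of_all _ fun x => ?_)
    rw [Real.norm_of_nonneg (hvge x), Real.norm_of_nonneg (hU0 x)]
    exact hvle x
  have hvD : MemD s p (fun x => U x - ε * g (U x)) :=
    ⟨hvLp, (le_self_add.trans hen).trans_lt hUE⟩
  have hGD : MemD s p (fun x => G (U x)) := by
    refine ⟨hGLp, ?_⟩
    have h1 := (le_add_self.trans hen).trans_lt hUE
    refine lt_of_le_of_ne le_top fun h2 => ?_
    rw [h2, ENNReal.mul_top (by simpa using hc0)] at h1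
    exact lt_irrefl _ h1
  have h1 := hsob _ hvD
  have h2 := hsob _ hGD
  rw [eLpNorm_rpow_eq_integral (by linarith) hvLp p (by linarith)] at h1
  rw [eLpNorm_rpow_eq_integral (by linarith) hGLp p (by linarith), ← hJ] at h2
  have h3 : sobolevConst N s p * ENNReal.ofReal
      ((∫ x, |U x - ε * g (U x)| ^ r) ^ (p / r) + p * ε * (1 - ε * L) ^ (p - 1) * J)
      ≤ sobolevConst N s p * 1 := by
    rw [mul_one, ENNReal.ofReal_add (by positivity) (by positivity), mul_add,
      ENNReal.ofReal_mul hc0.le]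
    calc _ ≤ _ := add_le_add h1 (by rw [mul_left_comm]; exact mul_le_mul_right h2 _)
      _ ≤ _ := hen
      _ = _ := hUS
  rw [ENNReal.mul_le_mul_iff_right hS0 hST, ENNReal.ofReal_le_one] at h3
  refine le_trans (add_le_add (Real.rpow_le_rpow hεI.le ?_
    (div_nonneg (by linarith) (by linarith))) le_rfl) h3
  have hvi : Integrable (fun x => |U x - ε * g (U x)| ^ r) := by
    have := hvLp.integrable_norm_rpow (by simpa using by linarith) ENNReal.ofReal_ne_top
    rwa [ENNReal.toReal_ofReal (by linarith)] at this
  calc 1 - ε * (r * I) = ∫ x, (U x ^ r - ε * (r * (U x ^ (r - 1) * g (U x)))) := by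
        rw [integral_sub hUi ((hIi.const_mul r).const_mul ε), integral_const_mul,
          integral_const_mul, hU1']
    _ ≤ _ := by
        refine integral_mono (hUi.sub ((hIi.const_mul r).const_mul ε)) hvi fun x => ?_
        dsimp only
        rw [abs_of_nonneg (hvge x)]
        have := rpow_sub_rpow_le_mul_sub (q := r) (by linarith) (hvge x) (hvle x)
        rw [sub_sub_cancel] at this
        linarith

theorem eLpNorm_rpow_eq_lintegral {r : ℝ} (hr : 0 < r) (hu : ∀ x, 0 ≤ u x) (e : ℝ) :
    eLpNorm u (ENNReal.ofReal r) volume ^ e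
      = (∫⁻ x, ENNReal.ofReal (u x ^ r)) ^ (e / r) := by
  rw [eLpNorm_eq_lintegral_rpow_enorm_toReal (by simpa using hr) ENNReal.ofReal_ne_top,
    ENNReal.toReal_ofReal hr.le, ← ENNReal.rpow_mul, one_div_mul_eq_div]
  congr 2 with x
  rw [Real.enorm_of_nonneg (hu x), ENNReal.ofReal_rpow_of_nonneg (hu x) hr.le]

/-! ### The weak-type estimate -/

theorem isTestPair_min {t : ℝ} (ht : 0 < t) (hp : 1 < p) :
    IsTestPair p 1 (fun a => min a t) (fun a => min a t) where
  measurable_left := by fun_prop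
  measurable_right := by fun_prop
  left_zero := by simp [ht.le]
  right_zero := by simp [ht.le]
  mono a b _ hba := sub_nonneg.2 (min_le_min_right t hba)
  lipschitz a b _ hba := by
    rw [one_mul]
    rcases min_cases a t with h | h <;> rcases min_cases b t with h' | h' <;> linarith
  abs_sub_rpow_le a b hb hba := by
    have h0 : 0 ≤ min a t - min b t := sub_nonneg.2 (min_le_min_right t hba)
    have h1 : min a t - min b t ≤ a - b := by
      rcases min_cases a t with h | h <;> rcases min_cases b t with h' | h' <;> linarith
    rw [abs_of_nonneg h0]
    rcases h0.eq_or_lt with h | h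
    · rw [← h, Real.zero_rpow (by linarith), mul_zero]
    · have e : (min a t - min b t) ^ p = (min a t - min b t) ^ (p - 1) * (min a t - min b t) := by
        rw [← Real.rpow_add_one h.ne']; congr 1; ring
      rw [e]
      gcongr

theorem one_div_borderExp (hs0 : 0 < s) (hp : 1 < p) (hN : s * p < N) :
    1 / borderExp N s p = p / critExp N s p / (p - 1) := by
  have : (0 : ℝ) < N := by nlinarith
  have : (N : ℝ) - s * p ≠ 0 := by linarith
  have : p - 1 ≠ 0 := by linarith
  rw [borderExp, critExp]
  field_simp

/-- Testing with the truncation `min U t`. -/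
theorem IsMinimizer.mul_volume_rpow_le (hs0 : 0 < s) (hp : 1 < p) (hN : s * p < N)
    (hU : IsMinimizer s p U) (hUm : Measurable U) (hU0 : ∀ x, 0 ≤ U x) {t : ℝ} (ht : 0 < t) :
    ENNReal.ofReal t * volume {x | t < U x} ^ (1 / borderExp N s p)
      ≤ eLpNorm U (ENNReal.ofReal (critExp N s p - 1)) volume
          ^ ((critExp N s p - 1) / (p - 1)) := by
  have hpr := lt_critExp hs0 hp hN
  have h := (isTestPair_min ht hp).eLpNorm_comp_rpow_le zero_le_one hs0 hp hN hU hUm hU0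
  rw [one_div_borderExp hs0 hp hN]
  set r := critExp N s p
  have hr0 : 0 < r := by linarith
  have hm0 : ∀ x, 0 ≤ min (U x) t := fun x => le_min (hU0 x) ht.le
  rw [eLpNorm_rpow_eq_lintegral hr0 hm0] at h
  rw [eLpNorm_rpow_eq_lintegral (by linarith) hU0]
  set Z := ∫⁻ x, ENNReal.ofReal (U x ^ (r - 1))
  set A := volume {x | t < U x}
  have h1 : ∫⁻ x, ENNReal.ofReal (U x ^ (r - 1) * min (U x) t) ≤ ENNReal.ofReal t * Z := by
    rw [← lintegral_const_mul' _ _ ENNReal.ofReal_ne_top]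
    refine lintegral_mono fun x => ?_
    rw [← ENNReal.ofReal_mul ht.le, mul_comm]
    have := Real.rpow_nonneg (hU0 x) (r - 1)
    gcongr
    exact min_le_right _ _
  have h2 : ENNReal.ofReal (t ^ r) * A ≤ ∫⁻ x, ENNReal.ofReal (min (U x) t ^ r) := by
    rw [← setLIntegral_const]
    refine (setLIntegral_mono_ae ?_ ?_).trans (setLIntegral_le_lintegral {x | t < U x} _)
    · exact (((hUm.min measurable_const).pow_const r).ennreal_ofReal).aemeasurable
    · refine ae_of_all _ fun x (hx : t < U x) => ?_
      rw [min_eq_right hx.le]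
  have hT0 : ENNReal.ofReal t ≠ 0 := by simpa using ht
  have hTt : ENNReal.ofReal t ≠ ∞ := ENNReal.ofReal_ne_top
  have h3 : ENNReal.ofReal t * (ENNReal.ofReal t ^ (p - 1) * A ^ (p / r))
      ≤ ENNReal.ofReal t * Z := by
    refine le_trans ?_ ((ENNReal.rpow_le_rpow h2 (by positivity)).trans (h.trans h1))
    rw [ENNReal.mul_rpow_of_nonneg _ _ (by positivity), ← ENNReal.ofReal_rpow_of_pos ht,
      ← ENNReal.rpow_mul, mul_div_cancel₀ _ hr0.ne', ← mul_assoc]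
    gcongr
    conv_lhs => rw [← ENNReal.rpow_one (ENNReal.ofReal t), ← ENNReal.rpow_mul, one_mul]
    rw [← ENNReal.rpow_add _ _ hT0 hTt]
    simp
  rw [ENNReal.mul_le_mul_iff_right hT0 hTt] at h3
  have hp1 : 0 < p - 1 := by linarith
  have h4 := ENNReal.rpow_le_rpow h3 (z := 1 / (p - 1)) (by positivity)
  rw [ENNReal.mul_rpow_of_nonneg _ _ (by positivity), ← ENNReal.rpow_mul, ← ENNReal.rpow_mul,
    mul_one_div_cancel hp1.ne', ENNReal.rpow_one, mul_one_div] at h4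
  refine h4.trans_eq ?_
  congr 1
  have : r - 1 ≠ 0 := by linarith
  field_simp

/-! ### Test pairs built from a weight -/

/-- Jensen's inequality for `t ↦ t ^ p` on an interval, without division by its length. -/
theorem intervalIntegral_rpow_le {w : ℝ → ℝ} (hp : 1 < p) (hw : Continuous w) (hw0 : ∀ t, 0 ≤ w t)
    {a b : ℝ} (hba : b ≤ a) :
    (∫ t in b..a, w t) ^ p ≤ (a - b) ^ (p - 1) * ∫ t in b..a, w t ^ p := by
  rcases hba.eq_or_lt with h | h
  · subst h; simp [Real.zero_rpow (show p ≠ 0 by linarith)]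
  have hd : 0 < a - b := sub_pos.2 h
  set m := (∫ t in b..a, w t) / (a - b) with hm
  have hI : ∫ t in b..a, w t = (a - b) * m := by rw [hm]; field_simp
  have hm0 : 0 ≤ m := div_nonneg (intervalIntegral.integral_nonneg hba fun t _ => hw0 t) hd.le
  have hwp : Continuous fun t => w t ^ p := hw.rpow_const fun _ => Or.inr (by linarith)
  -- integrate the tangent line inequality at the mean value `m`
  have h1 : ∫ t in b..a, (m ^ p + p * m ^ (p - 1) * (w t - m)) ≤ ∫ t in b..a, w t ^ p := by
    refine intervalIntegral.integral_mono_on hba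
      (Continuous.intervalIntegrable (by fun_prop) _ _) (hwp.intervalIntegrable _ _) fun t _ => ?_
    linarith [mul_sub_le_rpow_sub_rpow hp.le (hw0 t) hm0]
  rw [intervalIntegral.integral_add (by simp)
    (Continuous.intervalIntegrable (by fun_prop) _ _), intervalIntegral.integral_const_mul,
    intervalIntegral.integral_sub (hw.intervalIntegrable _ _) (by simp),
    intervalIntegral.integral_const, intervalIntegral.integral_const, hI, smul_eq_mul, smul_eq_mul,
    sub_self, mul_zero, add_zero] at h1
  have e : (a - b) ^ p = (a - b) ^ (p - 1) * (a - b) := by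
    rw [← Real.rpow_add_one hd.ne']; congr 1; ring
  rw [hI, Real.mul_rpow hd.le hm0, e, mul_assoc]
  gcongr

theorem isTestPair_intervalIntegral {w : ℝ → ℝ} {B : ℝ} (hp : 1 < p) (hw : Continuous w)
    (hw0 : ∀ t, 0 ≤ w t) (hwB : ∀ t, w t ≤ B) :
    IsTestPair p (B ^ p) (fun a => ∫ t in 0..a, w t ^ p) (fun a => ∫ t in 0..a, w t) := by
  have hwp : Continuous fun t => w t ^ p := hw.rpow_const fun _ => Or.inr (by linarith)
  have hsub : ∀ {f : ℝ → ℝ}, Continuous f → ∀ a b : ℝ,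
      (∫ t in 0..a, f t) - ∫ t in 0..b, f t = ∫ t in b..a, f t := fun hf a b =>
    intervalIntegral.integral_interval_sub_left (hf.intervalIntegrable _ _)
      (hf.intervalIntegrable _ _)
  refine ⟨
    (intervalIntegral.continuous_primitive (fun a b => hwp.intervalIntegrable a b) 0).measurable,
    (intervalIntegral.continuous_primitive (fun a b => hw.intervalIntegrable a b) 0).measurable,
    by simp, by simp, fun a b _ hba => ?_, fun a b _ hba => ?_, fun a b _ hba => ?_⟩
  · rw [hsub hwp]
    exact intervalIntegral.integral_nonneg hba fun t _ => Real.rpow_nonneg (hw0 t) _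
  · rw [hsub hwp]
    calc _ ≤ ∫ _ in b..a, B ^ p := intervalIntegral.integral_mono_on hba
          (hwp.intervalIntegrable _ _) (by simp) fun t _ =>
          Real.rpow_le_rpow (hw0 t) (hwB t) (by linarith)
      _ = _ := by rw [intervalIntegral.integral_const, smul_eq_mul, mul_comm]
  · rw [hsub hwp, hsub hw, abs_of_nonneg (intervalIntegral.integral_nonneg hba fun t _ => hw0 t)]
    exact intervalIntegral_rpow_le hp hw hw0 hba

/-! ### Higher and lower integrability by absorption -/

/-- A continuous weight, with a constant `C` for which `t w(t)` and `t w(t)^p` are comparable to the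
primitives of `w` and of `w^p` on `[0, ∞)`. -/
structure IsWeight (p C : ℝ) (w : ℝ → ℝ) : Prop where
  continuous : Continuous w
  nonneg : ∀ t, 0 ≤ w t
  bounded : ∃ B, ∀ t, w t ≤ B
  integral_rpow_le : ∀ ⦃t⦄, 0 ≤ t → ∫ τ in 0..t, w τ ^ p ≤ C * (t * w t ^ p)
  mul_le_integral : ∀ ⦃t⦄, 0 ≤ t → t * w t ≤ C * ∫ τ in 0..t, w τ

/-- The reverse inequality from which integrability is extracted: `F = U w(U)` satisfies
`‖F‖_r^p ≤ C^{p+1} ∫ U^{r-p} F^p`. -/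
theorem IsMinimizer.eLpNorm_mul_weight_rpow_le (hs0 : 0 < s) (hp : 1 < p) (hN : s * p < N)
    (hU : IsMinimizer s p U) (hUm : Measurable U) (hU0 : ∀ x, 0 ≤ U x) {w : ℝ → ℝ} {C : ℝ}
    (hC : 0 ≤ C) (hw : IsWeight p C w) :
    eLpNorm (fun x => U x * w (U x)) (ENNReal.ofReal (critExp N s p)) volume ^ p
      ≤ ENNReal.ofReal (C ^ (p + 1)) * ∫⁻ x, ENNReal.ofReal (U x ^ critExp N s p * w (U x) ^ p) := by
  have hpr := lt_critExp hs0 hp hN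
  obtain ⟨B, hB⟩ := hw.bounded
  have hB0 : 0 ≤ B := (hw.nonneg 0).trans (hB 0)
  have h := (isTestPair_intervalIntegral hp hw.continuous hw.nonneg hB).eLpNorm_comp_rpow_le
    (by positivity) hs0 hp hN hU hUm hU0
  set r := critExp N s p
  have h1 : eLpNorm (fun x => U x * w (U x)) (ENNReal.ofReal r) volume
      ≤ ENNReal.ofReal C * eLpNorm (fun x => ∫ t in 0..U x, w t) (ENNReal.ofReal r) volume := by
    refine eLpNorm_le_mul_eLpNorm_of_ae_le_mul (ae_of_all _ fun x => ?_) _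
    rw [Real.norm_of_nonneg (mul_nonneg (hU0 x) (hw.nonneg _)), Real.norm_of_nonneg
      (intervalIntegral.integral_nonneg (hU0 x) fun t _ => hw.nonneg t)]
    exact hw.mul_le_integral (hU0 x)
  calc _ ≤ (ENNReal.ofReal C * eLpNorm (fun x => ∫ t in 0..U x, w t) (ENNReal.ofReal r) volume) ^ p :=
        ENNReal.rpow_le_rpow h1 (by linarith)
    _ = ENNReal.ofReal (C ^ p)
        * eLpNorm (fun x => ∫ t in 0..U x, w t) (ENNReal.ofReal r) volume ^ p := by
        rw [ENNReal.mul_rpow_of_nonneg _ _ (by linarith),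
          ENNReal.ofReal_rpow_of_nonneg hC (by linarith)]
    _ ≤ ENNReal.ofReal (C ^ p)
        * ∫⁻ x, ENNReal.ofReal (U x ^ (r - 1) * ∫ t in 0..U x, w t ^ p) := by gcongr
    _ ≤ ENNReal.ofReal (C ^ p)
        * ∫⁻ x, ENNReal.ofReal C * ENNReal.ofReal (U x ^ r * w (U x) ^ p) := by
        gcongr with x
        rw [← ENNReal.ofReal_mul hC]
        refine ENNReal.ofReal_le_ofReal ?_
        have e : U x ^ r = U x ^ (r - 1) * U x := by
          rcases (hU0 x).eq_or_lt with h0 | h0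
          · rw [← h0, mul_zero, Real.zero_rpow (by linarith)]
          · rw [← Real.rpow_add_one h0.ne']; congr 1; ring
        have := mul_le_mul_of_nonneg_left (hw.integral_rpow_le (hU0 x))
          (Real.rpow_nonneg (hU0 x) (r - 1))
        rw [e]
        linarith
    _ = _ := by
        rw [lintegral_const_mul' _ _ ENNReal.ofReal_ne_top, ← mul_assoc, ← ENNReal.ofReal_mul
          (by positivity)]
        congr 2
        rcases hC.eq_or_lt with h0 | h0
        · rw [← h0, mul_zero, Real.zero_rpow (by linarith)]
        · rw [Real.rpow_add_one h0.ne']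

/-- If `w ∘ U ≤ K` off a set `A` on which `U` has little mass, the contribution of `A` is absorbed
by Hölder's inequality; the resulting bound does not depend on the upper bound of `w`. -/
theorem IsMinimizer.eLpNorm_mul_weight_rpow_le_of_small (hs0 : 0 < s) (hp : 1 < p)
    (hN : s * p < N) (hU : IsMinimizer s p U) (hUm : Measurable U) (hU0 : ∀ x, 0 ≤ U x)
    {w : ℝ → ℝ} {C K : ℝ} (hC : 0 ≤ C) (hw : IsWeight p C w)
    {A : Set (EuclideanSpace ℝ (Fin N))} (hA : MeasurableSet A) (hK : ∀ x ∉ A, w (U x) ≤ K)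
    (hsmall : ENNReal.ofReal (C ^ (p + 1)) * (∫⁻ x in A, ENNReal.ofReal (U x ^ critExp N s p))
      ^ ((critExp N s p - p) / critExp N s p) ≤ 1 / 2) :
    eLpNorm (fun x => U x * w (U x)) (ENNReal.ofReal (critExp N s p)) volume ^ p
      ≤ 2 * (ENNReal.ofReal (C ^ (p + 1)) * ENNReal.ofReal (K ^ p)) := by
  have hpr := lt_critExp hs0 hp hN
  have h := hU.eLpNorm_mul_weight_rpow_le hs0 hp hN hUm hU0 hC hw
  obtain ⟨B, hB⟩ := hw.bounded
  have hwm := hw.continuous.measurable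
  obtain ⟨⟨⟨hULp, -⟩, hU1⟩, -⟩ := hU
  set r := critExp N s p
  have hr0 : 0 < r := by linarith
  have hF0 : ∀ x, 0 ≤ U x * w (U x) := fun x => mul_nonneg (hU0 x) (hw.nonneg _)
  have hU1' : ∫⁻ x, ENNReal.ofReal (U x ^ r) = 1 := by
    have h2 := eLpNorm_rpow_eq_integral hr0 hULp r hr0.le
    rwa [hU1, eLpNorm_rpow_eq_lintegral hr0 hU0, div_self hr0.ne', ENNReal.rpow_one, Real.one_rpow,
      ENNReal.ofReal_one] at h2
  have hfin : eLpNorm (fun x => U x * w (U x)) (ENNReal.ofReal r) volume ^ p ≠ ∞ := by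
    refine ENNReal.rpow_ne_top_of_nonneg (by linarith) (MemLp.eLpNorm_ne_top ?_)
    refine (hULp.const_mul B).mono (hUm.mul (hwm.comp hUm)).aestronglyMeasurable
      (ae_of_all _ fun x => ?_)
    rw [Real.norm_of_nonneg (hF0 x), norm_mul, Real.norm_of_nonneg (hU0 x), mul_comm]
    exact mul_le_mul_of_nonneg_right ((hB _).trans (Real.le_norm_self B)) (hU0 x)
  rw [eLpNorm_rpow_eq_lintegral hr0 hF0] at h hfin ⊢
  set X := (∫⁻ x, ENNReal.ofReal ((U x * w (U x)) ^ r)) ^ (p / r)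
  set D := ENNReal.ofReal (C ^ (p + 1))
  have hin : ∫⁻ x in A, ENNReal.ofReal (U x ^ r * w (U x) ^ p)
      ≤ (∫⁻ x in A, ENNReal.ofReal (U x ^ r)) ^ ((r - p) / r) * X := by
    calc _ = ∫⁻ x in A, ENNReal.ofReal (U x ^ r) ^ ((r - p) / r)
          * ENNReal.ofReal ((U x * w (U x)) ^ r) ^ (p / r) := by
          refine lintegral_congr fun x => ?_
          rw [ENNReal.ofReal_rpow_of_nonneg (Real.rpow_nonneg (hU0 x) _)
              (div_nonneg (by linarith) hr0.le),
            ENNReal.ofReal_rpow_of_nonneg (Real.rpow_nonneg (hF0 x) _) (by positivity),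
            ← ENNReal.ofReal_mul (Real.rpow_nonneg (Real.rpow_nonneg (hU0 x) _) _),
            ← Real.rpow_mul (hU0 x), ← Real.rpow_mul (hF0 x), mul_div_cancel₀ _ hr0.ne',
            mul_div_cancel₀ _ hr0.ne', Real.mul_rpow (hU0 x) (hw.nonneg _), ← mul_assoc]
          congr 2
          rcases (hU0 x).eq_or_lt with h0 | h0
          · rw [← h0, Real.zero_rpow hr0.ne', Real.zero_rpow (show p ≠ 0 by linarith), mul_zero]
          · rw [← Real.rpow_add h0, sub_add_cancel]
      _ ≤ (∫⁻ x in A, ENNReal.ofReal (U x ^ r)) ^ ((r - p) / r)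
          * (∫⁻ x in A, ENNReal.ofReal ((U x * w (U x)) ^ r)) ^ (p / r) := by
          refine ENNReal.lintegral_mul_norm_pow_le ?_ ?_ (div_nonneg (by linarith) hr0.le)
            (by positivity) (by field_simp; ring)
          · exact ((hUm.pow_const r).ennreal_ofReal).aemeasurable
          · exact ((hUm.mul (hwm.comp hUm)).pow_const r).ennreal_ofReal.aemeasurable
      _ ≤ _ := by
          exact mul_le_mul_right (ENNReal.rpow_le_rpow (setLIntegral_le_lintegral _ _)
            (by positivity)) _
  have hout : ∫⁻ x in Aᶜ, ENNReal.ofReal (U x ^ r * w (U x) ^ p) ≤ ENNReal.ofReal (K ^ p) := by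
    calc _ ≤ ∫⁻ x in Aᶜ, ENNReal.ofReal (K ^ p) * ENNReal.ofReal (U x ^ r) := by
          refine setLIntegral_mono' hA.compl fun x hx => ?_
          have hwK : w (U x) ^ p ≤ K ^ p :=
            Real.rpow_le_rpow (hw.nonneg _) (hK x hx) (by linarith)
          rw [← ENNReal.ofReal_mul ((Real.rpow_nonneg (hw.nonneg _) _).trans hwK), mul_comm]
          exact ENNReal.ofReal_le_ofReal (mul_le_mul_of_nonneg_right hwK
            (Real.rpow_nonneg (hU0 x) _))
      _ ≤ ENNReal.ofReal (K ^ p) * 1 := by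
          rw [lintegral_const_mul' _ _ ENNReal.ofReal_ne_top, ← hU1']
          exact mul_le_mul_right (setLIntegral_le_lintegral _ _) _
      _ = _ := mul_one _
  rw [← lintegral_add_compl _ hA] at h
  have h2 : X ≤ X / 2 + D * ENNReal.ofReal (K ^ p) := by
    calc X ≤ D * ((∫⁻ x in A, ENNReal.ofReal (U x ^ r)) ^ ((r - p) / r) * X
          + ENNReal.ofReal (K ^ p)) := h.trans (by gcongr)
      _ = D * (∫⁻ x in A, ENNReal.ofReal (U x ^ r)) ^ ((r - p) / r) * X
          + D * ENNReal.ofReal (K ^ p) := by ring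
      _ ≤ 1 / 2 * X + D * ENNReal.ofReal (K ^ p) := by gcongr
      _ = _ := by rw [one_div, mul_comm, ENNReal.div_eq_inv_mul, mul_comm]
  have h3 : X / 2 ≤ D * ENNReal.ofReal (K ^ p) := by
    have hX2 : X / 2 ≠ ∞ := ENNReal.div_ne_top hfin (by norm_num)
    rw [← ENNReal.add_le_add_iff_left hX2, ENNReal.add_halves]
    exact h2
  calc X = 2 * (X / 2) := (ENNReal.mul_div_cancel (by norm_num) (by norm_num)).symm
    _ ≤ _ := by gcongr

/-- Along a decreasing sequence of sets with negligible intersection, the smallness required for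
absorption is eventually met. -/
theorem exists_setLIntegral_rpow_small {f : EuclideanSpace ℝ (Fin N) → ℝ≥0∞}
    (hf : ∫⁻ x, f x ≠ ∞) {A : ℕ → Set (EuclideanSpace ℝ (Fin N))} (hA : ∀ n, MeasurableSet (A n))
    (hanti : Antitone A) (hzero : ∀ x, (∀ n, x ∈ A n) → f x = 0) {D : ℝ≥0∞} (hD : D ≠ ∞) {θ : ℝ}
    (hθ : 0 < θ) : ∃ n, D * (∫⁻ x in A n, f x) ^ θ ≤ 1 / 2 := by
  have h := tendsto_measure_iInter_atTop (μ := volume.withDensity f)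
    (fun n => (hA n).nullMeasurableSet) hanti ⟨0, by
      rw [withDensity_apply _ (hA 0)]
      exact ((setLIntegral_le_lintegral _ _).trans_lt hf.lt_top).ne⟩
  have h0 : volume.withDensity f (⋂ n, A n) = 0 := by
    rw [withDensity_apply _ (MeasurableSet.iInter hA), setLIntegral_congr_fun
      (MeasurableSet.iInter hA) (g := fun _ => 0) fun x hx => hzero x (mem_iInter.1 hx)]
    simp
  rw [h0] at h
  have h1 := ENNReal.Tendsto.const_mul (a := D)
    ((ENNReal.continuous_rpow_const (y := θ)).tendsto 0 |>.comp h) (Or.inr hD)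
  rw [ENNReal.zero_rpow_of_pos hθ, mul_zero] at h1
  obtain ⟨n, hn⟩ := (h1.eventually (gt_mem_nhds (show (0 : ℝ≥0∞) < 1 / 2 by norm_num))).exists
  refine ⟨n, ?_⟩
  simpa [withDensity_apply _ (hA n)] using hn.le

/-- Removal of the truncation by Fatou's lemma. -/
theorem IsMinimizer.memLp_of_isWeight (hs0 : 0 < s) (hp : 1 < p) (hN : s * p < N)
    (hU : IsMinimizer s p U) (hUm : Measurable U) (hU0 : ∀ x, 0 ≤ U x)
    {w : ℕ → ℝ → ℝ} {C K β : ℝ} (hC : 0 ≤ C) (hβ : 0 < β) (hw : ∀ n, IsWeight p C (w n))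
    (hlim : ∀ t, 0 ≤ t → Tendsto (fun n => t * w n t) atTop (𝓝 (t ^ β)))
    {A : Set (EuclideanSpace ℝ (Fin N))} (hA : MeasurableSet A)
    (hK : ∀ n, ∀ x ∉ A, w n (U x) ≤ K)
    (hsmall : ENNReal.ofReal (C ^ (p + 1)) * (∫⁻ x in A, ENNReal.ofReal (U x ^ critExp N s p))
      ^ ((critExp N s p - p) / critExp N s p) ≤ 1 / 2) :
    MemLp U (ENNReal.ofReal (β * critExp N s p)) volume := by
  have hpr := lt_critExp hs0 hp hN
  have hb := fun n => hU.eLpNorm_mul_weight_rpow_le_of_small hs0 hp hN hUm hU0 hC (hw n) hA (hK n)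
    hsmall
  have hp0 : 0 < p := by linarith
  simp_rw [← ENNReal.le_rpow_inv_iff hp0] at hb
  have hF := Lp.eLpNorm_lim_le_liminf_eLpNorm (p := ENNReal.ofReal (critExp N s p)) (μ := volume)
    (f := fun n x => U x * w n (U x))
    (fun n => (hUm.mul ((hw n).continuous.measurable.comp hUm)).aestronglyMeasurable)
    (fun x => U x ^ β) (ae_of_all _ fun x => hlim _ (hU0 x))
  have hlt := (hF.trans (liminf_le_of_frequently_le' (Frequently.of_forall hb))).trans_lt
    (b := _) (c := ∞) (ENNReal.rpow_lt_top_of_nonneg (by positivity)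
      (ENNReal.mul_ne_top (by norm_num) (ENNReal.mul_ne_top ENNReal.ofReal_ne_top
        ENNReal.ofReal_ne_top)))
  rw [← memLp_norm_rpow_iff (q := ENNReal.ofReal β) hUm.aestronglyMeasurable (by simpa using hβ)
    ENNReal.ofReal_ne_top, ENNReal.toReal_ofReal hβ.le, ← ENNReal.ofReal_div_of_pos hβ,
    mul_div_cancel_left₀ _ hβ.ne']
  refine ⟨(hUm.norm.pow_const β).aestronglyMeasurable, ?_⟩
  simpa only [Real.norm_of_nonneg (hU0 _)] using hlt

/-! ### Truncated powers as weights -/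

/-- The weight for exponents above `p*`: the power `t ^ γ` truncated at height `M`. The inner
`max` only serves to define it for negative `t`. -/
theorem isWeight_min_rpow (hp : 1 < p) {γ M : ℝ} (hγ : 0 ≤ γ) (hM : 0 ≤ M) :
    IsWeight p (2 ^ (1 + γ)) (fun t => min (max t 0) M ^ γ) := by
  have hc : Continuous fun t : ℝ => min (max t 0) M ^ γ :=
    Continuous.rpow_const (by fun_prop) fun _ => Or.inr hγ
  have hb0 : ∀ t : ℝ, 0 ≤ min (max t 0) M := fun t => le_min (le_max_right _ _) hM
  have h0 : ∀ t : ℝ, 0 ≤ min (max t 0) M ^ γ := fun t => Real.rpow_nonneg (hb0 t) _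
  have hmono : ∀ a b : ℝ, a ≤ b → min (max a 0) M ^ γ ≤ min (max b 0) M ^ γ := fun a b hab =>
    Real.rpow_le_rpow (hb0 a) (min_le_min_right _ (max_le_max_right _ hab)) hγ
  refine ⟨hc, h0, ⟨M ^ γ, fun t => Real.rpow_le_rpow (hb0 t) (min_le_right _ _) hγ⟩,
    fun t ht => ?_, fun t ht => ?_⟩
  · have h1 : ∫ τ in 0..t, (min (max τ 0) M ^ γ) ^ p
        ≤ ∫ _ in 0..t, (min (max t 0) M ^ γ) ^ p := by
      refine intervalIntegral.integral_mono_on ht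
        ((hc.rpow_const fun _ => Or.inr (by linarith)).intervalIntegrable _ _) (by simp)
        fun τ hτ => ?_
      exact Real.rpow_le_rpow (h0 _) (hmono _ _ hτ.2) (by linarith)
    rw [intervalIntegral.integral_const, smul_eq_mul, sub_zero] at h1
    refine h1.trans (le_mul_of_one_le_left (mul_nonneg ht (Real.rpow_nonneg (h0 t) _)) ?_)
    exact Real.one_le_rpow (by norm_num) (by linarith)
  · -- on `[t / 2, t]` the weight is at least `2 ^ (-γ)` times its value at `t`
    have h1 : ∫ _ in (t / 2)..t, min (max (t / 2) 0) M ^ γ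
        ≤ ∫ τ in (t / 2)..t, min (max τ 0) M ^ γ :=
      intervalIntegral.integral_mono_on (by linarith) (by simp) (hc.intervalIntegrable _ _)
        fun τ hτ => hmono _ _ hτ.1
    have h2 : ∫ τ in (t / 2)..t, min (max τ 0) M ^ γ ≤ ∫ τ in 0..t, min (max τ 0) M ^ γ :=
      intervalIntegral.integral_mono_interval (by linarith) (by linarith) le_rfl
        (ae_of_all _ h0) (hc.intervalIntegrable _ _)
    rw [intervalIntegral.integral_const, smul_eq_mul] at h1
    have h3 : min (max t 0) M ≤ 2 * min (max (t / 2) 0) M := by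
      rw [max_eq_left ht, max_eq_left (by linarith)]
      rcases min_cases (t / 2) M with h | h
      · rw [h.1]; linarith [min_le_left t M]
      · rw [h.1]; linarith [min_le_right t M]
    have h4 : min (max t 0) M ^ γ ≤ 2 ^ γ * min (max (t / 2) 0) M ^ γ := by
      rw [← Real.mul_rpow (by norm_num) (hb0 _)]
      exact Real.rpow_le_rpow (hb0 _) h3 hγ
    have h5 := h1.trans h2
    have e : (2 : ℝ) ^ (1 + γ) = 2 * 2 ^ γ := by
      rw [Real.rpow_add (by norm_num), Real.rpow_one]
    calc t * min (max t 0) M ^ γ ≤ t * (2 ^ γ * min (max (t / 2) 0) M ^ γ) := by gcongr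
      _ = 2 ^ (1 + γ) * ((t - t / 2) * min (max (t / 2) 0) M ^ γ) := by rw [e]; ring
      _ ≤ _ := by gcongr

/-- The weight for exponents below `p*`: the negative power `t ^ γ` truncated near zero. The
condition `-1 < γ p` is the local integrability of its `p`-th power. -/
theorem isWeight_max_rpow (hp : 1 < p) {γ δ : ℝ} (hγ : γ < 0) (hγp : -1 < γ * p) (hδ : 0 < δ) :
    IsWeight p (1 / (γ * p + 1)) (fun t => max t δ ^ γ) := by
  have hb0 : ∀ t : ℝ, 0 < max t δ := fun t => lt_max_of_lt_right hδ
  have hc : Continuous fun t : ℝ => max t δ ^ γ :=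
    Continuous.rpow_const (by fun_prop) fun t => Or.inl (hb0 t).ne'
  have h0 : ∀ t : ℝ, 0 ≤ max t δ ^ γ := fun t => Real.rpow_nonneg (hb0 t).le _
  have hcp : Continuous fun t : ℝ => (max t δ ^ γ) ^ p :=
    hc.rpow_const fun _ => Or.inr (by linarith)
  have hanti : ∀ a b : ℝ, a ≤ b → max b δ ^ γ ≤ max a δ ^ γ := fun a b hab =>
    Real.rpow_le_rpow_of_nonpos (hb0 a) (max_le_max_right _ hab) hγ.le
  have hpos : 0 < γ * p + 1 := by linarith
  have hC1 : 1 ≤ 1 / (γ * p + 1) := by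
    rw [le_div_iff₀ hpos]
    nlinarith
  refine ⟨hc, h0, ⟨δ ^ γ, fun t => Real.rpow_le_rpow_of_nonpos hδ (le_max_right _ _) hγ.le⟩,
    fun t ht => ?_, fun t ht => ?_⟩
  · rcases le_total t δ with htδ | htδ
    · have h1 : ∫ τ in 0..t, (max τ δ ^ γ) ^ p ≤ ∫ _ in 0..t, (max t δ ^ γ) ^ p := by
        refine intervalIntegral.integral_mono_on ht (hcp.intervalIntegrable _ _) (by simp)
          fun τ hτ => ?_
        rw [max_eq_right htδ, max_eq_right (hτ.2.trans htδ)]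
      rw [intervalIntegral.integral_const, smul_eq_mul, sub_zero] at h1
      exact h1.trans (le_mul_of_one_le_left (mul_nonneg ht (Real.rpow_nonneg (h0 t) _)) hC1)
    · have h1 : ∫ τ in 0..t, (max τ δ ^ γ) ^ p ≤ ∫ τ in 0..t, τ ^ (γ * p) := by
        refine intervalIntegral.integral_mono_on_of_le_Ioo ht (hcp.intervalIntegrable _ _)
          (intervalIntegral.intervalIntegrable_rpow' hγp) fun τ hτ => ?_
        rw [← Real.rpow_mul (hb0 τ).le]
        exact Real.rpow_le_rpow_of_nonpos hτ.1 (le_max_left _ _) (by nlinarith)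
      rw [integral_rpow (Or.inl hγp), Real.zero_rpow hpos.ne', sub_zero,
        Real.rpow_add_one (hδ.trans_le htδ).ne'] at h1
      rw [max_eq_left htδ, ← Real.rpow_mul ht, one_div_mul_eq_div, mul_comm t]
      exact h1
  · have h1 : ∫ _ in 0..t, max t δ ^ γ ≤ ∫ τ in 0..t, max τ δ ^ γ :=
      intervalIntegral.integral_mono_on ht (by simp) (hc.intervalIntegrable _ _)
        fun τ hτ => hanti _ _ hτ.2
    rw [intervalIntegral.integral_const, smul_eq_mul, sub_zero] at h1
    exact h1.trans (le_mul_of_one_le_left ((mul_nonneg ht (h0 t)).trans h1) hC1)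

/-! ### Integrability of minimizers -/

theorem IsMinimizer.lintegral_ne_top (hU : IsMinimizer s p U) (hr : 0 < critExp N s p)
    (hU0 : ∀ x, 0 ≤ U x) : ∫⁻ x, ENNReal.ofReal (U x ^ critExp N s p) ≠ ∞ := by
  have h := eLpNorm_rpow_eq_lintegral hr hU0 (critExp N s p)
  rw [div_self hr.ne', ENNReal.rpow_one] at h
  rw [← h]
  exact ENNReal.rpow_ne_top_of_nonneg hr.le hU.1.1.1.eLpNorm_ne_top

theorem IsMinimizer.memLp_of_critExp_le (hs0 : 0 < s) (hp : 1 < p) (hN : s * p < N)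
    (hU : IsMinimizer s p U) (hUm : Measurable U) (hU0 : ∀ x, 0 ≤ U x) {q : ℝ}
    (hq : critExp N s p ≤ q) : MemLp U (ENNReal.ofReal q) volume := by
  have hpr := lt_critExp hs0 hp hN
  have hr0 : 0 < critExp N s p := by linarith
  set γ := q / critExp N s p - 1 with hγdef
  have hγ : 0 ≤ γ := by rw [hγdef, sub_nonneg, le_div_iff₀ hr0]; linarith
  obtain ⟨n, hn⟩ := exists_setLIntegral_rpow_small (hU.lintegral_ne_top hr0 hU0)
    (A := fun n : ℕ => {x | (n : ℝ) < U x}) (fun n => measurableSet_lt measurable_const hUm)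
    (fun m n hmn x (hx : (n : ℝ) < U x) => (Nat.cast_le.2 hmn).trans_lt hx)
    (fun x hx => by
      obtain ⟨n, hn⟩ := exists_nat_ge (U x)
      exact absurd (hx n) (not_lt.2 hn))
    (D := ENNReal.ofReal ((2 ^ (1 + γ)) ^ (p + 1))) ENNReal.ofReal_ne_top
    (div_pos (sub_pos.2 hpr) hr0)
  have h := hU.memLp_of_isWeight (β := 1 + γ) (K := (n : ℝ) ^ γ) hs0 hp hN hUm hU0 (by positivity)
    (by linarith) (fun k : ℕ => isWeight_min_rpow hp hγ k.cast_nonneg) (fun t ht => ?_)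
    (measurableSet_lt measurable_const hUm) (fun k x hx => ?_) hn
  · convert h using 2
    rw [hγdef]; field_simp; ring
  · refine tendsto_const_nhds.congr' ?_
    filter_upwards [eventually_ge_atTop ⌈t⌉₊] with k hk
    rw [max_eq_left ht, min_eq_left ((Nat.le_ceil t).trans (Nat.cast_le.2 hk))]
    rcases ht.eq_or_lt with h0 | h0
    · rw [← h0, zero_mul, Real.zero_rpow (by linarith)]
    · rw [Real.rpow_add h0, Real.rpow_one]
  · have hx' : U x ≤ n := not_lt.1 hx
    refine Real.rpow_le_rpow (le_min (le_max_right _ _) k.cast_nonneg)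
      ((min_le_left _ _).trans (max_le hx' n.cast_nonneg)) hγ

theorem IsMinimizer.memLp_of_lt_critExp (hs0 : 0 < s) (hp : 1 < p) (hN : s * p < N)
    (hU : IsMinimizer s p U) (hUm : Measurable U) (hU0 : ∀ x, 0 ≤ U x) {q : ℝ}
    (hq0 : borderExp N s p < q) (hq : q < critExp N s p) : MemLp U (ENNReal.ofReal q) volume := by
  have hpr := lt_critExp hs0 hp hN
  have hr0 : 0 < critExp N s p := by linarith
  have hp0 : 0 < p := by linarith
  set γ := q / critExp N s p - 1 with hγdef
  have hγ : γ < 0 := by rw [hγdef, sub_neg, div_lt_one hr0]; exact hq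
  -- `q > q₀ = p* (p - 1) / p` is exactly the integrability of `t ^ (γ p)` at zero
  have hγp : -1 < γ * p := by
    have hN0 : (0 : ℝ) < N := by nlinarith
    have e : borderExp N s p = (p - 1) / p * critExp N s p := by
      rw [borderExp, critExp]; field_simp
    rw [e, ← lt_div_iff₀ hr0, div_lt_iff₀ hp0] at hq0
    rw [hγdef]; linarith
  have hγ1 : 0 < 1 + γ := by nlinarith
  obtain ⟨n, hn⟩ := exists_setLIntegral_rpow_small (hU.lintegral_ne_top hr0 hU0)
    (A := fun n : ℕ => {x | U x ≤ 1 / ((n : ℝ) + 1)})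
    (fun n => measurableSet_le hUm measurable_const)
    (fun m n hmn x (hx : U x ≤ 1 / ((n : ℝ) + 1)) => hx.trans (Nat.one_div_le_one_div hmn))
    (fun x hx => by
      have h1 : U x ≤ 0 := ge_of_tendsto' tendsto_one_div_add_atTop_nhds_zero_nat hx
      rw [le_antisymm h1 (hU0 x), Real.zero_rpow hr0.ne', ENNReal.ofReal_zero])
    (D := ENNReal.ofReal ((1 / (γ * p + 1)) ^ (p + 1))) ENNReal.ofReal_ne_top
    (div_pos (sub_pos.2 hpr) hr0)
  have h := hU.memLp_of_isWeight (β := 1 + γ) (K := (1 / ((n : ℝ) + 1)) ^ γ) hs0 hp hN hUm hU0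
    (by have : 0 < γ * p + 1 := by linarith
        positivity) hγ1
    (fun k : ℕ => isWeight_max_rpow hp hγ hγp (Nat.one_div_pos_of_nat (n := k)))
    (fun t ht => ?_) (measurableSet_le hUm measurable_const) (fun k x hx => ?_) hn
  · convert h using 2
    rw [hγdef]; field_simp; ring
  · rcases ht.eq_or_lt with h0 | h0
    · simp [← h0, Real.zero_rpow hγ1.ne']
    · refine tendsto_const_nhds.congr' ?_
      filter_upwards [tendsto_one_div_add_atTop_nhds_zero_nat.eventually (ge_mem_nhds h0)] with k hk
      rw [max_eq_left hk, Real.rpow_add h0, Real.rpow_one]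
  · have hx' : 1 / ((n : ℝ) + 1) < U x := not_le.1 hx
    exact Real.rpow_le_rpow_of_nonpos Nat.one_div_pos_of_nat
      (hx'.le.trans (le_max_left _ _)) hγ.le

theorem borderExp_lt_critExp_sub_one (hs0 : 0 < s) (hp : 1 < p) (hN : s * p < N) :
    borderExp N s p < critExp N s p - 1 := by
  have : 0 < s * p := by positivity
  rw [borderExp, critExp, lt_sub_iff_add_lt, div_add_one (by linarith)]
  gcongr
  linarith

end FracSobolev

theorem mainTheorem3 (N : ℕ) (s p : ℝ) (hs0 : 0 < s) (hs1 : s < 1) (hp : 1 < p)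
    (hN : s * p < (N : ℝ)) (U : EuclideanSpace ℝ (Fin N) → ℝ)
    (hU : FracSobolev.IsMinimizer s p U) (hU0 : 0 ≤ᵐ[volume] U) :
    (∀ q : ℝ, FracSobolev.borderExp N s p < q → MemLp U (ENNReal.ofReal q) volume) ∧
    FracSobolev.MemWeakLp (FracSobolev.borderExp N s p) U ∧
    (⨆ (t : ℝ) (_ : 0 < t),
        ENNReal.ofReal t * volume {x | t < U x} ^ (1 / FracSobolev.borderExp N s p))
      ≤ eLpNorm U (ENNReal.ofReal (FracSobolev.critExp N s p - 1)) volume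
          ^ ((FracSobolev.critExp N s p - 1) / (p - 1)) := by
  have hUm : AEStronglyMeasurable U volume := hU.1.1.1.1
  -- all assertions are invariant under modification on null sets, so `U` may be replaced by a
  -- measurable function that is nonnegative everywhere
  obtain ⟨V, hVm, hV0, hUV⟩ : ∃ V : EuclideanSpace ℝ (Fin N) → ℝ,
      Measurable V ∧ (∀ x, 0 ≤ V x) ∧ U =ᵐ[volume] V := by
    refine ⟨fun x => max (hUm.mk U x) 0, hUm.measurable_mk.max measurable_const,
      fun x => le_max_right _ _, ?_⟩
    filter_upwards [hUm.ae_eq_mk, hU0] with x h1 h2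
    rw [← h1, max_eq_left (show 0 ≤ U x from h2)]
  have hV := hU.congr_ae hUV
  have hLp : ∀ q : ℝ, FracSobolev.borderExp N s p < q → MemLp U (ENNReal.ofReal q) volume := by
    intro q hq
    refine MemLp.ae_eq hUV.symm ?_
    rcases le_or_gt (FracSobolev.critExp N s p) q with h | h
    · exact hV.memLp_of_critExp_le hs0 hp hN hVm hV0 h
    · exact hV.memLp_of_lt_critExp hs0 hp hN hVm hV0 hq h
  have hweak : ∀ t : ℝ, 0 < t →
      ENNReal.ofReal t * volume {x | t < U x} ^ (1 / FracSobolev.borderExp N s p)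
      ≤ eLpNorm U (ENNReal.ofReal (FracSobolev.critExp N s p - 1)) volume
          ^ ((FracSobolev.critExp N s p - 1) / (p - 1)) := by
    intro t ht
    have hset : {x | t < U x} =ᵐ[volume] {x | t < V x} := by
      refine Filter.eventuallyEq_set.2 ?_
      filter_upwards [hUV] with x hx
      rw [hx]
    rw [measure_congr hset, eLpNorm_congr_ae hUV]
    exact hV.mul_volume_rpow_le hs0 hp hN hVm hV0 ht
  refine ⟨hLp, ⟨hUm, ?_⟩, iSup₂_le hweak⟩
  have habs : ∀ t : ℝ, volume {x | t < |U x|} = volume {x | t < U x} := fun t => by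
    refine measure_congr (Filter.eventuallyEq_set.2 ?_)
    filter_upwards [hU0] with x hx
    rw [abs_of_nonneg (show 0 ≤ U x from hx)]
  have hpr := FracSobolev.lt_critExp hs0 hp hN
  unfold FracSobolev.weakLpNorm
  simp_rw [habs]
  refine (iSup₂_le hweak).trans_lt (ENNReal.rpow_lt_top_of_nonneg
    (div_nonneg (by linarith) (by linarith)) (MemLp.eLpNorm_ne_top (hLp _ ?_)))
  exact FracSobolev.borderExp_lt_critExp_sub_one hs0 hp hN
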